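/- Let $\Gamma$ be a Polish group, $X$ a Polish space, and let $\Gamma \curvearrowright X$ be a Borel action, i.e. a group action for which the map $\Gamma\times X\to X$, $(g,x)\mapsto g\cdot x$, is Borel. Let $E$ be its orbit equivalence relation: $x \mathrel{E} y$ if and only if $y = g\cdot x$ for some $g\in\Gamma$. Then $E$ is strongly Borel $3$-hypergraphable. That is, $E$ is analytic (as a subset of $X\times X$), and there is a Borel hypergraph $G$ on $X$ such that 1. each hyperedge of $G$ has at most $3$ points; 2. the points of each hyperedge of $G$ all lie in the same $E$-class; 3. if $x \mathrel{E} y$, then some hyperedge of $G$ contains both $x$ and $y$. Here a hypergraph $G$ on $X$ with finite hyperedges is *Borel* if for every $k$ the set of tuples $(x_1,\dots,x_k)\in X^k$ (repetitions allowed) such that $\{x_1,\dots,x_k\}$ is a hyperedge of $G$ is a Borel subset of $X^k$. -/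

import Mathlib

/-- A hypergraph on `X` with finite hyperedges is Borel if, for every `k`, the set of `k`-tuples
`(x₁, …, x_k)` (repetitions allowed) for which `{x₁, …, x_k}` is a hyperedge is a Borel subset of
`X ^ k`. -/
def Hypergraph.IsBorel {X : Type*} [MeasurableSpace X] (G : Hypergraph X) : Prop :=
  (∀ e ∈ G.edgeSet, e.Finite) ∧
    ∀ k : ℕ, MeasurableSet {x : Fin k → X | Set.range x ∈ G.edgeSet}

/-- An equivalence relation on a Polish space is analytic if it is an analytic subset of
`X × X`. -/
def Setoid.IsAnalytic {X : Type*} [TopologicalSpace X] (E : Setoid X) : Prop :=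
  MeasureTheory.AnalyticSet {p : X × X | E p.1 p.2}

/-- An analytic equivalence relation `E` on `X` is strongly Borel `n`-hypergraphable if there is a
Borel hypergraph with vertex set `X` whose hyperedges have at most `n` points and are each
contained in a single `E`-class, and such that any two `E`-equivalent points lie in a common
hyperedge. -/
def Setoid.IsStronglyBorelHypergraphable {X : Type*} [TopologicalSpace X] [MeasurableSpace X]
    (E : Setoid X) (n : ℕ) : Prop :=
  E.IsAnalytic ∧
    ∃ G : Hypergraph X, G.vertexSet = Set.univ ∧ G.IsBorel ∧
      (∀ e ∈ G.edgeSet, e.encard ≤ n) ∧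
      (∀ e ∈ G.edgeSet, ∀ x ∈ e, ∀ y ∈ e, E x y) ∧
      (∀ x y : X, E x y → ∃ e ∈ G.edgeSet, x ∈ e ∧ y ∈ e)

/-!
The orbit equivalence relation `E` is the projection of the Borel set of `(x, y, g)` with `y = g • x`
along the group, and in general it is not Borel. The third point of a hyperedge replaces the group
element `g`: where it can, a point `z` of the orbit of `x` is used to code `g`.

Points are divided according to whether their stabilizer is meagre. The category quantifier
preserves Borel sets (`measurableSet_isMeagre_section`), so this is a Borel division, and moreover
the set of pairs `(x, y)` with `{g | g • x = y}` nonmeagre is a Borel subset of `E`. When the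
stabilizer of `x` is not meagre, neither is any of its translates `{g | g • x = y}` with `y` in the
orbit, and so this Borel set takes care of all pairs `(x, y)` in `E`.

On the Borel set `W` of points with meagre stabilizer, all fibres of the orbit maps `g ↦ g • x` are
meagre. Each orbit map is then injective on some Cantor set, and this Cantor set can be chosen
measurably in `x` (`exists_measurable_injective_of_isMeagre_fiber`): there is a Borel map
`h : W × (ℕ → Bool) → Γ` such that `r ↦ h (x, r) • x` is injective for all `x`. The orbit maps are
only Borel, but they are continuous enough along a comeagre set, uniformly in `x`
(`MeasurableSet.genericallyOpen`), to carry out the usual construction of a Cantor scheme. With a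
Borel injection `ι` from `Γ` to Cantor space, the Borel map `(x, g) ↦ (x, g • x, h (x, ι g) • x)` is
injective, so by the Lusin–Souslin theorem its range is a Borel set of triples of `E`-equivalent
points, and its projection to the first two coordinates is all of `E` restricted to `W`.
-/

open Set Topology TopologicalSpace MeasureTheory

/-! ### Uniform Baire property and the category quantifier -/

section GenericallyOpen

variable {W Γ : Type*} {U : ℕ → Set Γ}

/-- The subset of `W × Γ` whose section at `w` is the union of those members `U k` of the sequence
`U` for which `w ∈ A k`. For measurable `A` and a basis `U`, this is a measurable family of open
subsets of `Γ`. -/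
def basicUnion (U : ℕ → Set Γ) (A : ℕ → Set W) : Set (W × Γ) :=
  ⋃ k, A k ×ˢ U k

lemma mem_basicUnion {A : ℕ → Set W} {w : W} {g : Γ} :
    (w, g) ∈ basicUnion U A ↔ ∃ k, w ∈ A k ∧ g ∈ U k := by
  simp [basicUnion]

lemma isOpen_section_basicUnion [TopologicalSpace Γ] (hU : IsTopologicalBasis (range U))
    (A : ℕ → Set W) (w : W) : IsOpen {g | (w, g) ∈ basicUnion U A} := by
  simp only [mem_basicUnion, ofPred_exists]
  refine isOpen_iUnion fun k => ?_
  by_cases hw : w ∈ A k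
  · simpa [hw] using hU.isOpen (mem_range_self k)
  · simp [hw]

/-- A subset `B` of `W × Γ` is generically open if, uniformly measurably in `w : W`, its section at
`w` agrees with an open set (coded by `A`) on the intersection of countably many dense open sets
(coded by `D`). -/
def GenericallyOpen [TopologicalSpace Γ] [MeasurableSpace W] (U : ℕ → Set Γ)
    (B : Set (W × Γ)) : Prop :=
  ∃ A : ℕ → Set W, (∀ k, MeasurableSet (A k)) ∧
    ∃ D : ℕ → ℕ → Set W, (∀ m k, MeasurableSet (D m k)) ∧
      (∀ m w, Dense {g | (w, g) ∈ basicUnion U (D m)}) ∧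
      ∀ w g, (∀ m, (w, g) ∈ basicUnion U (D m)) → ((w, g) ∈ B ↔ (w, g) ∈ basicUnion U A)

variable [TopologicalSpace Γ] [MeasurableSpace W]

lemma GenericallyOpen.basicUnion (hU : IsTopologicalBasis (range U)) {A : ℕ → Set W}
    (hA : ∀ k, MeasurableSet (A k)) : GenericallyOpen U (basicUnion U A) := by
  refine ⟨A, hA, fun _ _ => univ, fun _ _ => .univ, fun m w => ?_, fun w g _ => Iff.rfl⟩
  convert dense_univ
  ext g
  have : g ∈ ⋃₀ range U := hU.sUnion_eq ▸ mem_univ g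
  simpa [mem_basicUnion] using this

lemma GenericallyOpen.compl (hU : IsTopologicalBasis (range U)) {B : Set (W × Γ)}
    (hB : GenericallyOpen U B) : GenericallyOpen U Bᶜ := by
  obtain ⟨A, hA, D, hD, hDd, hAB⟩ := hB
  -- `A'` codes the interior of the complement of the open set coded by `A`
  let A' : ℕ → Set W := fun k => {w | ∀ j, w ∈ A j → Disjoint (U j) (U k)}
  have hA' : ∀ k, MeasurableSet (A' k) := fun k => by
    simp only [A', ofPred_forall]
    refine .iInter fun j => ?_
    by_cases h : Disjoint (U j) (U k)
    · simp [h]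
    · simp only [h, imp_false]
      exact (hA j).compl
  refine ⟨A', hA', fun m => m.casesOn (fun k => A k ∪ A' k) D, ?_, ?_, ?_⟩
  · rintro (_ | m) k
    · exact (hA k).union (hA' k)
    · exact hD m k
  · rintro (_ | m) w
    · rw [hU.dense_iff]
      rintro _ ⟨i, rfl⟩ ⟨g, hg⟩
      by_cases h : ∃ j, w ∈ A j ∧ ¬ Disjoint (U j) (U i)
      · obtain ⟨j, hj, hji⟩ := h
        obtain ⟨g', hg'j, hg'i⟩ := not_disjoint_iff.1 hji
        exact ⟨g', hg'i, mem_basicUnion.2 ⟨j, .inl hj, hg'j⟩⟩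
      · push Not at h
        exact ⟨g, hg, mem_basicUnion.2 ⟨i, .inr h, hg⟩⟩
    · exact hDd m w
  · intro w g h
    rw [mem_compl_iff, hAB w g fun m => h (m + 1)]
    constructor
    · intro hg
      obtain ⟨k, hk | hk, hgk⟩ := mem_basicUnion.1 (h 0)
      · exact absurd (mem_basicUnion.2 ⟨k, hk, hgk⟩) hg
      · exact mem_basicUnion.2 ⟨k, hk, hgk⟩
    · intro hg hg'
      obtain ⟨k, hk, hgk⟩ := mem_basicUnion.1 hg
      obtain ⟨j, hj, hgj⟩ := mem_basicUnion.1 hg'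
      exact disjoint_left.1 (hk j hj) hgj hgk

lemma GenericallyOpen.iUnion {B : ℕ → Set (W × Γ)} (hB : ∀ n, GenericallyOpen U (B n)) :
    GenericallyOpen U (⋃ n, B n) := by
  choose A hA D hD hDd hAB using hB
  refine ⟨fun k => ⋃ n, A n k, fun k => .iUnion fun n => hA n k,
    fun m => D m.unpair.1 m.unpair.2, fun m => hD _ _, fun m => hDd _ _, fun w g h => ?_⟩
  have key : ∀ n, (w, g) ∈ B n ↔ (w, g) ∈ _root_.basicUnion U (A n) := fun n =>
    hAB n w g fun m => by simpa using h (Nat.pair n m)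
  simp only [mem_iUnion, key, mem_basicUnion]
  grind

/-- Every Borel subset of `W × Γ` has the Baire property uniformly in the first coordinate. -/
lemma MeasurableSet.genericallyOpen [SecondCountableTopology Γ] [MeasurableSpace Γ] [BorelSpace Γ]
    (hU : IsTopologicalBasis (range U)) {B : Set (W × Γ)} (hB : MeasurableSet B) :
    GenericallyOpen U B := by
  let M : MeasurableSpace (W × Γ) :=
    { MeasurableSet' := GenericallyOpen U
      measurableSet_empty := by
        simpa [_root_.basicUnion] using
          GenericallyOpen.basicUnion hU (A := fun _ => (∅ : Set W)) fun _ => .empty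
      measurableSet_compl := fun _ => GenericallyOpen.compl hU
      measurableSet_iUnion := fun _ => GenericallyOpen.iUnion }
  have hM : (Prod.instMeasurableSpace : MeasurableSpace (W × Γ)) ≤ M := by
    refine sup_le ?_ ?_
    · rintro _ ⟨S, hS, rfl⟩
      have := GenericallyOpen.basicUnion hU (A := fun _ => S) fun _ => hS
      have hcover : ⋃ k, U k = univ := by rw [← sUnion_range, hU.sUnion_eq]
      rwa [_root_.basicUnion, ← prod_iUnion, hcover, prod_univ] at this
    · rw [BorelSpace.measurable_eq (α := Γ), hU.borel_eq_generateFrom,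
        MeasurableSpace.comap_generateFrom]
      refine MeasurableSpace.generateFrom_le ?_
      rintro _ ⟨_, ⟨k, rfl⟩, rfl⟩
      have := GenericallyOpen.basicUnion hU (A := fun j => {_w : W | j = k}) fun j => .const _
      have heq : (Prod.snd ⁻¹' U k : Set (W × Γ)) =
          _root_.basicUnion U fun j => {_w : W | j = k} := by
        ext ⟨w, g⟩
        simp [mem_basicUnion]
      exact heq ▸ this
  exact hM _ hB

end GenericallyOpen

lemma exists_seq_nonempty_isTopologicalBasis (Γ : Type*) [TopologicalSpace Γ]
    [SecondCountableTopology Γ] [Nonempty Γ] :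
    ∃ U : ℕ → Set Γ, IsTopologicalBasis (range U) ∧ ∀ k, (U k).Nonempty := by
  obtain ⟨b, hbc, hb0, hb⟩ := exists_countable_basis Γ
  have hbn : b.Nonempty := by
    by_contra h
    have := hb.sUnion_eq
    rw [not_nonempty_iff_eq_empty.1 h, sUnion_empty] at this
    exact empty_ne_univ this
  obtain ⟨U, rfl⟩ := hbc.exists_eq_range hbn
  exact ⟨U, hb, fun k => nonempty_iff_ne_empty.2 fun h => hb0 ⟨k, h⟩⟩

/-- The category quantifier preserves Borel sets: up to a meagre set the section at `w` is the
open set coded by `A`, so it is meagre exactly when `w` lies in no `A k`. -/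
lemma measurableSet_isMeagre_section {W Γ : Type*} [MeasurableSpace W] [TopologicalSpace Γ]
    [SecondCountableTopology Γ] [BaireSpace Γ] [Nonempty Γ] [MeasurableSpace Γ] [BorelSpace Γ]
    {B : Set (W × Γ)} (hB : MeasurableSet B) :
    MeasurableSet {w | IsMeagre {g | (w, g) ∈ B}} := by
  obtain ⟨U, hU, hne⟩ := exists_seq_nonempty_isTopologicalBasis Γ
  obtain ⟨A, hA, D, hD, hDd, hAB⟩ := hB.genericallyOpen hU
  have hres : ∀ w, {g | ∀ m, (w, g) ∈ basicUnion U (D m)} ∈ residual Γ := fun w => by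
    rw [ofPred_forall]
    exact countable_iInter_mem.2 fun m =>
      residual_of_dense_open (isOpen_section_basicUnion hU _ w) (hDd m w)
  suffices {w | IsMeagre {g | (w, g) ∈ B}} = ⋂ k, (A k)ᶜ by
    rw [this]
    exact .iInter fun k => (hA k).compl
  ext w
  simp only [mem_ofPred_eq, mem_iInter, mem_compl_iff]
  constructor
  · intro hm k hk
    obtain ⟨g, hgk, hg, hgB⟩ := (dense_of_mem_residual
      (Filter.inter_mem (hres w) hm)).inter_open_nonempty (U k) (hU.isOpen ⟨k, rfl⟩) (hne k)
    exact hgB ((hAB w g hg).2 (mem_basicUnion.2 ⟨k, hk, hgk⟩))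
  · intro h
    refine Filter.mem_of_superset (hres w) fun g hg hgB => ?_
    obtain ⟨k, hk, -⟩ := mem_basicUnion.1 ((hAB w g hg).1 hgB)
    exact h k hk

/-! ### Measurable families of Cantor sets -/

section CantorScheme

/-- The branch through the binary tree labelled by `ℕ` in which a node at level `n` with label `k`
has children labelled `child n k true` and `child n k false`, following the directions `r`. -/
def branchNode (child : ℕ → ℕ → Bool → ℕ) (r : ℕ → Bool) : ℕ → ℕ
  | 0 => 0
  | n + 1 => child n (branchNode child r n) (r n)

lemma branchNode_congr (child : ℕ → ℕ → Bool → ℕ) {r r' : ℕ → Bool} {n : ℕ}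
    (h : ∀ i < n, r i = r' i) : branchNode child r n = branchNode child r' n := by
  induction n with
  | zero => rfl
  | succ n ih => rw [branchNode, branchNode, ih fun i hi => h i (by omega), h n (by omega)]

/-- The points determined by a measurable family of Cantor schemes of vanishing diameter depend
measurably on the scheme and the branch. -/
lemma exists_measurable_mem_branchNode {W Γ : Type*} [MeasurableSpace W] [MetricSpace Γ]
    [CompleteSpace Γ] [MeasurableSpace Γ] [BorelSpace Γ]
    {U : ℕ → Set Γ} (hne : ∀ k, (U k).Nonempty) (child : W → ℕ → ℕ → Bool → ℕ)
    (hmeas : ∀ n k b, Measurable fun w => child w n k b)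
    (hcl : ∀ w n k b, closure (U (child w n k b)) ⊆ U k)
    (hdiam : ∀ w n k b, ∀ x ∈ U (child w n k b), ∀ y ∈ U (child w n k b),
      dist x y < 1 / ((n : ℝ) + 1)) :
    ∃ h : W × (ℕ → Bool) → Γ, Measurable h ∧
      ∀ w r n, h (w, r) ∈ U (branchNode (child w) r n) := by
  choose p hp using hne
  have hnode : ∀ n, Measurable fun q : W × (ℕ → Bool) => branchNode (child q.1) q.2 n := by
    intro n
    induction n with
    | zero => exact measurable_const
    | succ n ih =>
      have hc : Measurable fun q : W × (ℕ × Bool) => child q.1 n q.2.1 q.2.2 :=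
        measurable_from_prod_countable_left fun y => hmeas n y.1 y.2
      exact hc.comp (measurable_fst.prodMk
        (ih.prodMk ((measurable_pi_apply n).comp measurable_snd)))
  have hanti : ∀ w r, Antitone fun n => U (branchNode (child w) r n) := fun w r =>
    antitone_nat_of_succ_le fun n => subset_closure.trans (hcl w n _ _)
  have hlim : ∀ q : W × (ℕ → Bool), ∃ x, Filter.Tendsto
      (fun n => p (branchNode (child q.1) q.2 n)) Filter.atTop (𝓝 x) := by
    rintro ⟨w, r⟩
    refine cauchySeq_tendsto_of_complete (Metric.cauchySeq_iff.2 fun ε hε => ?_)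
    obtain ⟨N, hN⟩ := exists_nat_one_div_lt hε
    refine ⟨N + 1, fun m hm n hn => (hdiam w N (branchNode (child w) r N) (r N) _ ?_ _ ?_).trans hN⟩
    · exact hanti w r hm (hp _)
    · exact hanti w r hn (hp _)
  choose h hh using hlim
  refine ⟨h, measurable_of_tendsto_metrizable
    (fun n => (measurable_from_nat (f := p)).comp (hnode n)) (tendsto_pi_nhds.2 hh),
    fun w r n => hcl w n _ (r n) (mem_closure_of_tendsto (hh (w, r)) ?_)⟩
  filter_upwards [Filter.eventually_ge_atTop (n + 1)] with m hm
  exact hanti w r hm (hp _)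

/-- A measurable family of maps `f w : Γ → X` with meagre fibres admits a measurable family of
Cantor sets `h w` in `Γ` on which `f w` is injective. The scheme for `w` stays inside the countably
many dense open sets relative to which the preimages under `f w` of a countable separating family
are open, and at each node its two children are sent to different sides of a member of that family.
-/
lemma exists_measurable_injective_of_isMeagre_fiber {W Γ X : Type*} [MeasurableSpace W]
    [TopologicalSpace Γ] [PolishSpace Γ] [Nonempty Γ] [MeasurableSpace Γ] [BorelSpace Γ]
    [MeasurableSpace X] [MeasurableSpace.CountablySeparated X]
    {f : W × Γ → X} (hf : Measurable f) (hmeagre : ∀ w x, IsMeagre {g | f (w, g) = x}) :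
    ∃ h : W × (ℕ → Bool) → Γ, Measurable h ∧
      ∀ w, Function.Injective fun r => f (w, h (w, r)) := by
  classical
  let := upgradeIsCompletelyMetrizable Γ
  obtain ⟨U, hU, hne⟩ := exists_seq_nonempty_isTopologicalBasis Γ
  obtain ⟨S, hS, hsep⟩ := exists_seq_separating X (p := MeasurableSet) MeasurableSet.empty univ
  let T : ℕ → Bool → Set X := fun n b => if b then S n else (S n)ᶜ
  have hT : ∀ n b, MeasurableSet (T n b) := by
    rintro n (_ | _)
    · exact (hS n).compl
    · exact hS n
  have hTdisj : ∀ n x b, x ∈ T n b → x ∉ T n (!b) := by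
    rintro n x (_ | _) <;> simp [T]
  choose A hA D hD hDd hAB using fun n b => (hf (hT n b)).genericallyOpen hU
  -- `e` lists all the dense open sets on whose intersection the family is well behaved
  obtain ⟨e, he⟩ := exists_surjective_nat (ℕ × Bool × ℕ)
  let E : ℕ → ℕ → Set W := fun i => D (e i).1 (e i).2.1 (e i).2.2
  have hEB : ∀ w g, (∀ i, (w, g) ∈ basicUnion U (E i)) → ∀ n b,
      (f (w, g) ∈ T n b ↔ (w, g) ∈ basicUnion U (A n b)) := by
    intro w g h n b
    refine hAB n b w g fun m => ?_
    obtain ⟨i, hi⟩ := he (n, b, m)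
    simpa [E, hi] using h i
  have hres : ∀ w, {g | ∀ i, (w, g) ∈ basicUnion U (E i)} ∈ residual Γ := fun w => by
    rw [ofPred_forall]
    exact countable_iInter_mem.2 fun i =>
      residual_of_dense_open (isOpen_section_basicUnion hU _ w) (hDd _ _ _ w)
  -- `Good i k a w`: `U a` may be a child of `U k` at level `i` in the scheme for `w`
  let Good : ℕ → ℕ → ℕ → W → Prop := fun i k a w =>
    closure (U a) ⊆ U k ∧ (∀ x ∈ U a, ∀ y ∈ U a, dist x y < 1 / ((i : ℝ) + 1)) ∧
      ∃ j, w ∈ E i j ∧ U a ⊆ U j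
  -- asking `U a` to lie in a single coded `U j`, rather than in their union, keeps this measurable
  have hcode : ∀ {C : ℕ → Set W}, (∀ j, MeasurableSet (C j)) → ∀ a,
      MeasurableSet {w | ∃ j, w ∈ C j ∧ U a ⊆ U j} := fun hC a => by
    rw [ofPred_exists]
    exact .iUnion fun j => (hC j).inter (.const _)
  have hGood : ∀ i k a, MeasurableSet {w | Good i k a w} := fun i k a =>
    (MeasurableSet.const _).inter ((MeasurableSet.const _).inter (hcode (hD _ _ _) a))
  have exists_good : ∀ i k w g O, g ∈ U k → (w, g) ∈ basicUnion U (E i) → IsOpen O → g ∈ O →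
      ∃ a, Good i k a w ∧ U a ⊆ O := by
    intro i k w g O hgk hgE hO hgO
    obtain ⟨j, hj, hgj⟩ := mem_basicUnion.1 hgE
    have hε : (0 : ℝ) < 1 / ((i : ℝ) + 1) / 2 := by positivity
    have hnhds : U k ∩ U j ∩ O ∩ Metric.ball g (1 / ((i : ℝ) + 1) / 2) ∈ 𝓝 g :=
      ((((hU.isOpen ⟨k, rfl⟩).inter (hU.isOpen ⟨j, rfl⟩)).inter hO).inter
        Metric.isOpen_ball).mem_nhds ⟨⟨⟨hgk, hgj⟩, hgO⟩, Metric.mem_ball_self hε⟩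
    obtain ⟨_, ⟨a, rfl⟩, -, ha⟩ := hU.exists_closure_subset hnhds
    have ha' := subset_closure.trans ha
    refine ⟨a, ⟨fun x hx => (ha hx).1.1.1, fun x hx y hy => ?_, j, hj, fun x hx => (ha' hx).1.1.2⟩,
      fun x hx => (ha' hx).1.2⟩
    have h1 := Metric.mem_ball.1 (ha' hx).2
    have h2 := Metric.mem_ball'.1 (ha' hy).2
    linarith [dist_triangle x g y]
  -- `Sub a n b w`: generically `f w` maps `U a` into `T n b`
  let Sub : ℕ → ℕ → Bool → W → Prop := fun a n b w => ∃ j, w ∈ A n b j ∧ U a ⊆ U j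
  have hSub : ∀ a n b, MeasurableSet {w | Sub a n b w} := fun a n b =>
    hcode (hA n b) a
  let Q : ℕ → ℕ → W → ℕ → Prop := fun i k w c =>
    Good i k c.unpair.1 w ∧ Good i k c.unpair.2 w ∧
      ∃ n, Sub c.unpair.1 n true w ∧ Sub c.unpair.2 n false w
  have hQmeas : ∀ i k c, MeasurableSet {w | Q i k w c} := fun i k c => by
    have : MeasurableSet {w | ∃ n, Sub c.unpair.1 n true w ∧ Sub c.unpair.2 n false w} := by
      rw [ofPred_exists]
      exact .iUnion fun n => (hSub _ _ _).inter (hSub _ _ _)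
    exact (hGood _ _ _).inter ((hGood _ _ _).inter this)
  have hQ : ∀ i k w, ∃ c, Q i k w c := by
    intro i k w
    have hkopen := hU.isOpen (mem_range_self k)
    obtain ⟨g, hgk, hg⟩ := (dense_of_mem_residual (hres w)).inter_open_nonempty _ hkopen (hne k)
    -- the fibre through `g` is meagre, so it misses a generic point of `U k`
    obtain ⟨g', hgk', hg', hgg'⟩ := (dense_of_mem_residual (Filter.inter_mem (hres w)
      (hmeagre w (f (w, g))))).inter_open_nonempty _ hkopen (hne k)
    obtain ⟨n, hn⟩ : ∃ n, ¬ (f (w, g) ∈ S n ↔ f (w, g') ∈ S n) := by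
      by_contra! h
      exact hgg' (hsep _ (mem_univ _) _ (mem_univ _) h).symm
    have main : ∀ g g', g ∈ U k → g' ∈ U k → (∀ i, (w, g) ∈ basicUnion U (E i)) →
        (∀ i, (w, g') ∈ basicUnion U (E i)) → f (w, g) ∈ T n true → f (w, g') ∈ T n false →
        ∃ c, Q i k w c := by
      intro g g' hgk hgk' hg hg' hgT hgT'
      obtain ⟨j, hj, hgj⟩ := mem_basicUnion.1 ((hEB w g hg _ _).1 hgT)
      obtain ⟨j', hj', hgj'⟩ := mem_basicUnion.1 ((hEB w g' hg' _ _).1 hgT')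
      obtain ⟨a, ha, haj⟩ := exists_good i k w g _ hgk (hg i) (hU.isOpen ⟨j, rfl⟩) hgj
      obtain ⟨b, hb, hbj⟩ := exists_good i k w g' _ hgk' (hg' i) (hU.isOpen ⟨j', rfl⟩) hgj'
      refine ⟨Nat.pair a b, ?_⟩
      simp only [Q, Nat.unpair_pair]
      exact ⟨ha, hb, n, ⟨j, hj, haj⟩, ⟨j', hj', hbj⟩⟩
    by_cases hS : f (w, g) ∈ S n
    · exact main g g' hgk hgk' hg hg' (by simpa [T] using hS) (by simp [T]; tauto)
    · exact main g' g hgk' hgk hg' hg (by simp [T]; tauto) (by simpa [T] using hS)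
  let child : W → ℕ → ℕ → Bool → ℕ := fun w i k b =>
    if b then (Nat.find (hQ i k w)).unpair.1 else (Nat.find (hQ i k w)).unpair.2
  have hchild : ∀ w i k b, Good i k (child w i k b) w := by
    rintro w i k (_ | _)
    · exact (Nat.find_spec (hQ i k w)).2.1
    · exact (Nat.find_spec (hQ i k w)).1
  have hsplit : ∀ w i k, ∃ n, ∀ b, Sub (child w i k b) n b w := by
    intro w i k
    obtain ⟨n, h1, h0⟩ := (Nat.find_spec (hQ i k w)).2.2
    exact ⟨n, by rintro (_ | _); exacts [h0, h1]⟩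
  obtain ⟨h, hh, hmem⟩ := exists_measurable_mem_branchNode hne child
    (fun i k b => by
      have := measurable_find (fun w => hQ i k w) (hQmeas i k)
      cases b
      · exact (measurable_from_nat (f := fun c => c.unpair.2)).comp this
      · exact (measurable_from_nat (f := fun c => c.unpair.1)).comp this)
    (fun w i k b => (hchild w i k b).1) (fun w i k b => (hchild w i k b).2.1)
  refine ⟨h, hh, fun w r r' hrr' => ?_⟩
  have hgen : ∀ r i, (w, h (w, r)) ∈ basicUnion U (E i) := fun r i => by
    obtain ⟨j, hj, hsub⟩ := (hchild w i (branchNode (child w) r i) (r i)).2.2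
    exact mem_basicUnion.2 ⟨j, hj, hsub (hmem w r (i + 1))⟩
  by_contra hne'
  -- the two branches part at the first level where `r` and `r'` differ
  have hex : ∃ m, r m ≠ r' m := Function.ne_iff.1 hne'
  obtain ⟨m, hm, hlt⟩ : ∃ m, r m ≠ r' m ∧ ∀ i < m, r i = r' i :=
    ⟨Nat.find hex, Nat.find_spec hex, fun i hi => not_not.1 (Nat.find_min hex hi)⟩
  obtain ⟨n, hn⟩ := hsplit w m (branchNode (child w) r m)
  have hside : ∀ s : ℕ → Bool, branchNode (child w) s m = branchNode (child w) r m →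
      f (w, h (w, s)) ∈ T n (s m) := by
    intro s hs
    obtain ⟨j, hj, hsub⟩ := hn (s m)
    refine (hEB w _ (hgen s) _ _).2 (mem_basicUnion.2 ⟨j, hj, hsub ?_⟩)
    have := hmem w s (m + 1)
    rwa [branchNode, hs] at this
  have h1 := hside r rfl
  have h2 := hside r' (branchNode_congr _ hlt).symm
  rw [Bool.eq_not_of_ne hm.symm] at h2
  exact hTdisj _ _ _ h1 (by simpa only [hrr'] using h2)

end CantorScheme

/-! ### Hypergraphs given by triples -/

section Hypergraph

variable {X : Type*}

/-- The hypergraph on `X` whose hyperedges are the sets `{x, y, z}` for `(x, y, z) ∈ R`. -/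
def Hypergraph.ofTriples (R : Set (X × X × X)) : Hypergraph X where
  vertexSet := univ
  edgeSet := (fun p : X × X × X => {p.1, p.2.1, p.2.2}) '' R
  subset_vertexSet_of_mem_edgeSet' _ _ := subset_univ _

lemma Hypergraph.isBorel_ofTriples [MeasurableSpace X] [MeasurableEq X]
    {R : Set (X × X × X)} (hR : MeasurableSet R) : (ofTriples R).IsBorel := by
  refine ⟨?_, fun k => ?_⟩
  · rintro _ ⟨p, -, rfl⟩
    exact toFinite _
  -- the points of a hyperedge are listed by the tuple, so a triple in `R` witnessing that its range
  -- is a hyperedge is given by three indices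
  have : {x : Fin k → X | range x ∈ (ofTriples R).edgeSet} =
      ⋃ (i) (j) (l), {x | (x i, x j, x l) ∈ R} ∩ ⋂ m, ({x | x m = x i} ∪ {x | x m = x j} ∪
        {x | x m = x l}) := by
    ext x
    simp only [ofTriples, mem_ofPred_eq, mem_image, mem_iUnion, mem_inter_iff, mem_iInter,
      mem_union]
    constructor
    · rintro ⟨⟨a, b, c⟩, hp, hx⟩
      obtain ⟨i, rfl⟩ : a ∈ range x := hx ▸ by simp
      obtain ⟨j, rfl⟩ : b ∈ range x := hx ▸ by simp
      obtain ⟨l, rfl⟩ : c ∈ range x := hx ▸ by simp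
      refine ⟨i, j, l, hp, fun m => ?_⟩
      have : x m ∈ range x := mem_range_self m
      rw [← hx] at this
      simpa [or_assoc] using this
    · rintro ⟨i, j, l, hp, hm⟩
      refine ⟨_, hp, Subset.antisymm ?_ ?_⟩
      · rintro y (rfl | rfl | rfl) <;> exact mem_range_self _
      · rintro _ ⟨m, rfl⟩
        simpa [or_assoc] using hm m
  rw [this]
  refine .iUnion fun i => .iUnion fun j => .iUnion fun l => ?_
  have hm : ∀ i, Measurable fun x : Fin k → X => x i := measurable_pi_apply
  refine MeasurableSet.inter (((hm i).prodMk ((hm j).prodMk (hm l))) hR) (.iInter fun m => ?_)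
  exact ((measurableSet_eq_fun (hm m) (hm i)).union (measurableSet_eq_fun (hm m) (hm j))).union
    (measurableSet_eq_fun (hm m) (hm l))

end Hypergraph

/-! ### Borel actions -/

section Action

variable {Γ X : Type*} [Group Γ] [TopologicalSpace Γ] [MulAction Γ X]

section Transporter

variable [IsTopologicalGroup Γ]

/-- The elements carrying `x` to `k • x` form a left translate of the stabilizer of `x`. -/
lemma isMeagre_transporter_smul_iff (k : Γ) (x : X) :
    IsMeagre {g : Γ | g • x = k • x} ↔ IsMeagre {g : Γ | g • x = x} := by
  constructor <;> intro h
  · have := h.preimage_of_isOpenMap (continuous_const_mul k) (isOpenMap_mul_left k)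
    simpa [preimage, mul_smul] using this
  · have := h.preimage_of_isOpenMap (continuous_const_mul k⁻¹) (isOpenMap_mul_left k⁻¹)
    simpa [preimage, mul_smul, inv_smul_eq_iff] using this

lemma isMeagre_transporter {x : X} (h : IsMeagre {g : Γ | g • x = x}) (y : X) :
    IsMeagre {g : Γ | g • x = y} := by
  by_cases hy : ∃ k : Γ, k • x = y
  · obtain ⟨k, rfl⟩ := hy
    exact (isMeagre_transporter_smul_iff k x).2 h
  · push Not at hy
    simpa [hy] using IsMeagre.empty

end Transporter

variable [PolishSpace Γ] [MeasurableSpace Γ] [BorelSpace Γ] [TopologicalSpace X] [PolishSpace X]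
  [MeasurableSpace X] [BorelSpace X] [MeasurableSMul₂ Γ X]

lemma isAnalytic_orbitRel : (MulAction.orbitRel Γ X).IsAnalytic := by
  have hm : Measurable fun q : Γ × X => (q.1 • q.2, q.2) := measurable_smul.prodMk measurable_snd
  have := MeasurableSet.univ.analyticSet_image hm
  rw [image_univ] at this
  have heq : {p : X × X | MulAction.orbitRel Γ X p.1 p.2} =
      range fun q : Γ × X => (q.1 • q.2, q.2) := by
    ext ⟨x, y⟩
    simp [MulAction.orbitRel_apply, MulAction.mem_orbit_iff]
  change AnalyticSet _
  exact heq ▸ this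

/-- The pairs `(x, y)` with `y = g • x` for only meagrely many `g` form a Borel set. This uses only
that the action is Borel, and does not need the orbit equivalence relation to be Borel. -/
lemma measurableSet_isMeagre_transporter :
    MeasurableSet {p : X × X | IsMeagre {g : Γ | g • p.1 = p.2}} := by
  have hB : MeasurableSet {q : (X × X) × Γ | q.2 • q.1.1 = q.1.2} :=
    measurableSet_eq_fun (measurable_snd.smul measurable_fst.fst) measurable_fst.snd
  exact measurableSet_isMeagre_section hB

/-- There is a Borel set of triples of orbit equivalent points whose projection to the first two
coordinates is the whole orbit equivalence relation. Where stabilizers are meagre, the third point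
codes a group element carrying the first point to the second; elsewhere the pairs themselves form a
Borel set and the third point is redundant. -/
lemma exists_measurableSet_triples_orbitRel [IsTopologicalGroup Γ] :
    ∃ R : Set (X × X × X), MeasurableSet R ∧
      (∀ x y z, (x, y, z) ∈ R → MulAction.orbitRel Γ X y x ∧ MulAction.orbitRel Γ X z x) ∧
      ∀ (x : X) (g : Γ), ∃ z, (x, g • x, z) ∈ R := by
  let M : Set (X × X) := {p | IsMeagre {g : Γ | g • p.1 = p.2}}
  have hM : MeasurableSet M := measurableSet_isMeagre_transporter
  let W : Set X := {x | (x, x) ∈ M}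
  have hW : MeasurableSet W := (measurable_id.prodMk measurable_id) hM
  have : StandardBorelSpace W := hW.standardBorel
  have hf : Measurable fun q : W × Γ => q.2 • (q.1 : X) :=
    measurable_snd.smul (measurable_subtype_coe.comp measurable_fst)
  obtain ⟨h, hh, hinj⟩ := exists_measurable_injective_of_isMeagre_fiber hf
    fun w x => isMeagre_transporter w.2 x
  obtain ⟨ι, hι, hιinj⟩ := MeasurableSpace.measurable_injection_nat_bool_of_countablySeparated Γ
  -- the third point of the triple determines `g`
  let T : W × Γ → X × X × X := fun q => (q.1, q.2 • (q.1 : X), h (q.1, ι q.2) • (q.1 : X))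
  have hT : Measurable T :=
    (measurable_subtype_coe.comp measurable_fst).prodMk (hf.prodMk
      ((hh.comp (measurable_fst.prodMk (hι.comp measurable_snd))).smul
        (measurable_subtype_coe.comp measurable_fst)))
  have hTinj : Function.Injective T := by
    rintro ⟨w, g⟩ ⟨w', g'⟩ heq
    simp only [T, Prod.mk.injEq] at heq
    obtain ⟨hw, -, hz⟩ := heq
    obtain rfl := Subtype.ext hw
    rw [hιinj (hinj w hz)]
  let N : Set (X × X × X) := {p | (p.1, p.2.1) ∉ M ∧ p.2.2 = p.2.1}
  have hN : MeasurableSet N :=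
    ((measurable_fst.prodMk measurable_snd.fst) hM.compl).inter
      (measurableSet_eq_fun measurable_snd.snd measurable_snd.fst)
  refine ⟨range T ∪ N, (hT.measurableEmbedding hTinj).measurableSet_range.union hN, ?_, ?_⟩
  · rintro x y z (⟨⟨w, g⟩, heq⟩ | ⟨hxy, hzy⟩)
    · simp only [T, Prod.mk.injEq] at heq
      obtain ⟨rfl, rfl, rfl⟩ := heq
      exact ⟨MulAction.mem_orbit _ _, MulAction.mem_orbit _ _⟩
    · obtain ⟨g, hg⟩ := nonempty_of_not_isMeagre hxy
      obtain rfl : z = y := hzy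
      exact ⟨⟨g, hg⟩, ⟨g, hg⟩⟩
  · intro x g
    by_cases hx : x ∈ W
    · exact ⟨_, .inl ⟨(⟨x, hx⟩, g), rfl⟩⟩
    · exact ⟨g • x, .inr ⟨fun hg => hx ((isMeagre_transporter_smul_iff g x).1 hg), rfl⟩⟩

end Action

theorem mainTheorem11 {Γ : Type*} {X : Type*}
    [Group Γ] [TopologicalSpace Γ] [IsTopologicalGroup Γ] [PolishSpace Γ]
    [MeasurableSpace Γ] [BorelSpace Γ]
    [TopologicalSpace X] [PolishSpace X] [MeasurableSpace X] [BorelSpace X]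
    [MulAction Γ X] [MeasurableSMul₂ Γ X] :
    (MulAction.orbitRel Γ X).IsStronglyBorelHypergraphable 3 := by
  refine ⟨isAnalytic_orbitRel, ?_⟩
  obtain ⟨R, hR, hRE, hcover⟩ := exists_measurableSet_triples_orbitRel (Γ := Γ) (X := X)
  refine ⟨.ofTriples R, rfl, Hypergraph.isBorel_ofTriples hR, ?_, ?_, ?_⟩
  · rintro _ ⟨p, -, rfl⟩
    refine (encard_insert_le _ _).trans ?_
    refine (add_le_add_left (encard_insert_le _ _) 1).trans ?_
    rw [encard_singleton]
    norm_num
  · rintro _ ⟨⟨a, b, c⟩, hp, rfl⟩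
    obtain ⟨hb, hc⟩ := hRE a b c hp
    have key : ∀ x ∈ ({a, b, c} : Set X), MulAction.orbitRel Γ X x a := by
      rintro x (rfl | rfl | rfl)
      exacts [Setoid.refl' _ _, hb, hc]
    exact fun x hx y hy => Setoid.trans' _ (key x hx) (Setoid.symm' _ (key y hy))
  · rintro _ y ⟨g, rfl⟩
    obtain ⟨z, hz⟩ := hcover y g
    exact ⟨_, mem_image_of_mem _ hz, by simp, by simp⟩
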